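/- **Model.** Consider $n\ge 1$ nodes $V=\{1,\dots,n\}$ on the complete graph with loops. Nodes know $n$, the payload length $b$ and their own identifier. A *message* consists of a sender $v\in V$, a position $i\in\{1,\dots,n\}$, a destination $d\in V$ and a payload of $b\ge 0$ bits. Communication is synchronous and reliable: in each round every node may send over each link (to each node, itself included) at most one object in the message format, and it receives what was sent to it. Every node has a private infinite sequence of independent unbiased random bits, independent between nodes. Depending on its identifier, its own messages, its random bits and what it has received so far, a node decides by unrestricted (measurable) local computation what to send in the next round, or to terminate with an output; a node that has terminated no longer communicates. **Task.** In the *symmetric information distribution task* each node $v$ initially holds messages $m_v^1,\dots,m_v^n$ with sender $v$, positions $1,\dots,n$, and arbitrary destinations and payloads, such that the set $\mathcal R_w$ of all messages with destination $w$ satisfies $|\mathcal R_w|=n$ for every $w\in V$. The nodes have to deliver all messages: every node $w$ must terminate with output $\mathcal R_w$. **Theorem.** There is an asymptotically optimal randomized algorithm for the symmetric information distribution task, i.e. one that takes $\mathcal O(1)$ rounds with high probability. Precisely: 1. There is a randomized algorithm $\mathcal A$ (one protocol for each pair $(n,b)$) that never errs (for every instance and all outcomes of the random bits, every node $w$ that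 terminates outputs $\mathcal R_w$), and such that for every real constant $c>0$ there is a constant $K\in\mathbb N$, depending only on $c$, such that for all $n\ge1$, all $b\ge 0$ and every instance with these parameters, with probability at least $1-1/n^c$ all nodes have terminated with the correct output within $K$ rounds. 2. The order of this bound cannot be improved: if $n\ge 2$, $b\ge 0$, and some randomized algorithm (possibly erring) solves every instance with parameters $(n,b)$ within $T$ rounds with probability greater than $1/2$, then $T\ge 1$. -/

import Mathlib

open MeasureTheory

namespace InfoDistribution

/-- A message in a system of `n` nodes with payloads of `b` bits.  It explicitly carries its
destination, and it is distinguishable from every other message because it carries the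
identifier of its original sender and its position in that sender's list.  This is also the
format of everything that travels over a link: one link carries at most one such message
per round (about `3 log n + b` bits). -/
@[ext]
structure Msg (n b : ℕ) where
  src : Fin n
  idx : Fin n
  dest : Fin n
  payload : Fin b → Bool
deriving DecidableEq

/-- Input of the information distribution task, with `n` messages `m_v^i` (`i : Fin n`) given
to every node `v`; destinations and payloads are arbitrary. -/
structure Task (n b : ℕ) where
  dest : Fin n → Fin n → Fin n
  payload : Fin n → Fin n → Fin b → Bool

namespace Task

variable {n b : ℕ}

/-- The `i`-th message `m_v^i` that node `v` has to send. -/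
def msg (I : Task n b) (v i : Fin n) : Msg n b :=
  ⟨v, i, I.dest v i, I.payload v i⟩

/-- The set `S_v` of messages initially held by `v`. -/
def sent (I : Task n b) (v : Fin n) : Finset (Msg n b) :=
  Finset.univ.image (I.msg v)

/-- The set `R_v` of messages that have to be delivered to `v`. -/
def received (I : Task n b) (v : Fin n) : Finset (Msg n b) :=
  (Finset.univ.biUnion I.sent).filter (fun m => m.dest = v)

/-- The symmetric task: every node has to send and to receive exactly `n` messages. -/
def IsSymmetric (I : Task n b) : Prop :=
  ∀ v, (I.sent v).card = n ∧ (I.received v).card = n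

end Task

/-- What a node does at the beginning of a round: it either sends at most one message over each
of its `n` links (the loop included), or it terminates and outputs a set of messages. -/
inductive Action (n b : ℕ) where
  | send (out : Fin n → Option (Msg n b))
  | halt (result : Finset (Msg n b))

/-- What a node has seen of the communication: the list, latest round first, of what it received
from each node in the rounds so far. -/
abbrev View (n b : ℕ) := List (Fin n → Option (Msg n b))

/-- A randomized algorithm on the complete graph with loops on the nodes `Fin n`, synchronous and
reliable, one message per link, direction and round.  A node acts on its identifier, its own
messages, its private random bits and the messages received so far; local computation is
unrestricted (measurable in the random bits). -/
structure Protocol (n b : ℕ) where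
  act : (v : Fin n) → (own : Fin n → Msg n b) → (bits : ℕ → Bool) → View n b → Action n b
  measurable_act : ∀ v own h a, MeasurableSet {bits : ℕ → Bool | act v own bits h = a}

namespace Protocol

variable {n b : ℕ}

/-- The view of a node after `t` rounds of the execution on input `I` with random bits `ρ`.
A node that has terminated neither sends nor receives any more. -/
def view (A : Protocol n b) (I : Task n b) (ρ : Fin n → ℕ → Bool) : ℕ → Fin n → View n b
  | 0, _ => []
  | t + 1, v =>
    match A.act v (I.msg v) (ρ v) (view A I ρ t v) with
    | .halt _ => view A I ρ t v
    | .send _ =>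
      (fun u =>
        match A.act u (I.msg u) (ρ u) (view A I ρ t u) with
        | .halt _ => none
        | .send out => out v) :: view A I ρ t v

/-- The output of `v` if it has terminated within `t` rounds, and `none` otherwise. -/
def result (A : Protocol n b) (I : Task n b) (ρ : Fin n → ℕ → Bool) (t : ℕ) (v : Fin n) :
    Option (Finset (Msg n b)) :=
  match A.act v (I.msg v) (ρ v) (A.view I ρ t v) with
  | .halt R => some R
  | .send _ => none

/-- Within `t` rounds all nodes have terminated, each with exactly the messages destined to it. -/
def SolvesWithin (A : Protocol n b) (I : Task n b) (ρ : Fin n → ℕ → Bool) (t : ℕ) : Prop :=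
  ∀ v, A.result I ρ t v = some (I.received v)

/-- The algorithm never errs: on each symmetric input and for all random bits, a node that
terminates outputs exactly the messages destined to it. -/
def IsCorrect (A : Protocol n b) : Prop :=
  ∀ I : Task n b, I.IsSymmetric → ∀ ρ t v R, A.result I ρ t v = some R → R = I.received v

end Protocol

/-- Every node has its own infinite sequence of independent unbiased random bits, independent of
those of the other nodes. -/
noncomputable def coins (n : ℕ) : Measure (Fin n → ℕ → Bool) :=
  Measure.pi fun _ => Measure.infinitePi fun _ => (PMF.uniformOfFintype Bool).toMeasure

end InfoDistribution

namespace InfoDistribution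

/-! No randomness is needed: a deterministic protocol solves every symmetric instance within 560
rounds, so the success probability is 1. Since local computation is unrestricted, it is enough to
say what each node sends as a function of what it knows. `Learnable` is a calculus of such
knowledge, and `Learnable.exists_protocol` turns it into a protocol.

The routing (`learnable_received`) takes place on a grid `G × G` with `s = |G|` and `n ≤ s² ≤ 4n`;
virtual nodes with equal first coordinate form a group. Messages are scattered over intermediate
groups, balanced there by destination group, sent to their destination groups, balanced there by
destination, and delivered. Every node only splits evenly the classes that it holds itself. Rounding
costs at most one per pair (location, class), and `card_local_split_le` shows that this error never
exceeds the order of the main term, so no global coordination is required. Moves inside a group may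
load a pair of nodes with `O(s)` messages; `Learnable.shuffle` spreads them over the whole grid.

For the lower bound, a node that hears nothing cannot distinguish two instances that agree on its
own messages but require different outputs. -/

/-- The symmetric instances of the information distribution task. -/
abbrev SymTask (n b : ℕ) := {I : Task n b // I.IsSymmetric}

/-! ### Schedules and the protocols that they induce -/

/-- A global description of a communication pattern: `S t I u v` is what `u` sends to `v` in
round `t` on the instance `I`. -/
abbrev Schedule (n b : ℕ) := ℕ → SymTask n b → Fin n → Fin n → Option (Msg n b)

namespace Schedule

variable {n b : ℕ}

/-- What `v` has received in the first `t` rounds, latest round first. -/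
def history (S : Schedule n b) (I : SymTask n b) : ℕ → Fin n → View n b
  | 0, _ => []
  | t + 1, v => (fun u => S t I u v) :: history S I t v

/-- After `t` rounds, node `v` cannot tell the instances `I` and `J` apart. -/
def Indist (S : Schedule n b) (t : ℕ) (v : Fin n) (I J : SymTask n b) : Prop :=
  I.1.msg v = J.1.msg v ∧ S.history I t v = S.history J t v

/-- In the first `k` rounds, what a node sends depends only on what it knows. -/
def Realizable (S : Schedule n b) (k : ℕ) : Prop :=
  ∀ t < k, ∀ v I J, S.Indist t v I J → S t I v = S t J v

@[simp]
theorem length_history (S : Schedule n b) (I : SymTask n b) (t : ℕ) (v : Fin n) :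
    (S.history I t v).length = t := by
  induction t with
  | zero => rfl
  | succ t ih => simp [history, ih]

theorem history_update (S : Schedule n b) (k : ℕ)
    (X : SymTask n b → Fin n → Fin n → Option (Msg n b)) (I : SymTask n b) (v : Fin n)
    {t : ℕ} (ht : t ≤ k) : history (Function.update S k X) I t v = S.history I t v := by
  induction t with
  | zero => rfl
  | succ t ih =>
    have hne : t ≠ k := by omega
    simp [history, ih (by omega), Function.update_of_ne hne]

open Classical in
/-- The protocol in which every node follows the schedule `S` for `k` rounds, on the basis of some
instance consistent with its view, and then outputs the messages it has to receive. -/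
noncomputable def protocol (S : Schedule n b) (k : ℕ) : Protocol n b where
  act v own _ h :=
    if h.length < k then
      .send fun w =>
        if hI : ∃ I : SymTask n b, I.1.msg v = own ∧ S.history I h.length v = h then
          S h.length hI.choose v w
        else none
    else
      .halt <|
        if hI : ∃ I : SymTask n b, I.1.msg v = own ∧ S.history I h.length v = h then
          hI.choose.1.received v
        else ∅
  measurable_act _ _ _ _ := MeasurableSet.const _

/-- The instance chosen by the node may differ from the actual one, but both look the same to the
node, so realizability forces it to send the same. -/
theorem protocol_act_send (S : Schedule n b) {k : ℕ} (hS : S.Realizable k) (I : SymTask n b)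
    (bits : ℕ → Bool) {t : ℕ} (ht : t < k) (v : Fin n) :
    (S.protocol k).act v (I.1.msg v) bits (S.history I t v) = .send (S t I v) := by
  have hI : ∃ J : SymTask n b, J.1.msg v = I.1.msg v ∧
      S.history J (S.history I t v).length v = S.history I t v := ⟨I, rfl, by simp⟩
  have hspec := hI.choose_spec
  simp only [protocol, length_history, ht, if_true]
  congr 1
  funext w
  rw [dif_pos (by simpa using hI)]
  have : S t hI.choose v = S t I v := hS t ht v _ _ ⟨hspec.1, by simpa using hspec.2⟩
  simpa using congrFun this w

theorem protocol_act_halt (S : Schedule n b) {k : ℕ}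
    (hR : ∀ v I J, S.Indist k v I J → I.1.received v = J.1.received v) (I : SymTask n b)
    (bits : ℕ → Bool) (v : Fin n) :
    (S.protocol k).act v (I.1.msg v) bits (S.history I k v) = .halt (I.1.received v) := by
  have hI : ∃ J : SymTask n b, J.1.msg v = I.1.msg v ∧
      S.history J (S.history I k v).length v = S.history I k v := ⟨I, rfl, by simp⟩
  have hspec := hI.choose_spec
  simp only [protocol, length_history, lt_irrefl, if_false]
  congr 1
  rw [dif_pos (by simpa using hI)]
  have := hR v hI.choose I ⟨hspec.1, by simpa using hspec.2⟩
  simpa using this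

/-- All nodes halt simultaneously after `k` rounds, which freezes the views; hence the minimum. -/
theorem protocol_view (S : Schedule n b) {k : ℕ} (hS : S.Realizable k)
    (hR : ∀ v I J, S.Indist k v I J → I.1.received v = J.1.received v) (I : SymTask n b)
    (ρ : Fin n → ℕ → Bool) (t : ℕ) (v : Fin n) :
    (S.protocol k).view I.1 ρ t v = S.history I (min t k) v := by
  induction t generalizing v with
  | zero => simp [Protocol.view, history]
  | succ t ih =>
    simp only [Protocol.view, ih]
    rcases lt_or_ge t k with h | h
    · rw [min_eq_left h.le, min_eq_left (Nat.succ_le_of_lt h)]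
      simp only [protocol_act_send S hS I _ h, history]
    · rw [min_eq_right h, min_eq_right (h.trans t.le_succ)]
      simp only [protocol_act_halt S hR]

theorem protocol_result (S : Schedule n b) {k : ℕ} (hS : S.Realizable k)
    (hR : ∀ v I J, S.Indist k v I J → I.1.received v = J.1.received v) (I : SymTask n b)
    (ρ : Fin n → ℕ → Bool) (t : ℕ) (v : Fin n) :
    (S.protocol k).result I.1 ρ t v = if t < k then none else some (I.1.received v) := by
  unfold Protocol.result
  rw [protocol_view S hS hR]
  split_ifs with h
  · rw [min_eq_left h.le, protocol_act_send S hS I _ h]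
  · rw [min_eq_right (not_lt.1 h), protocol_act_halt S hR]

end Schedule

/-! ### A calculus of what can be learned in a number of rounds -/

variable {n b : ℕ}

theorem Task.mem_received_iff (I : Task n b) (w : Fin n) (m : Msg n b) :
    m ∈ I.received w ↔ ∃ v i, I.msg v i = m ∧ I.dest v i = w := by
  simp only [Task.received, Task.sent, Finset.mem_filter, Finset.mem_biUnion, Finset.mem_univ,
    true_and, Finset.mem_image]
  constructor
  · rintro ⟨⟨v, i, rfl⟩, h⟩
    exact ⟨v, i, rfl, h⟩
  · rintro ⟨v, i, rfl, h⟩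
    exact ⟨⟨v, i, rfl⟩, h⟩

theorem Task.card_sent (I : Task n b) (v : Fin n) : (I.sent v).card = n := by
  rw [Task.sent, Finset.card_image_of_injective, Finset.card_univ, Fintype.card_fin]
  intro i j h
  exact congrArg Msg.idx h

/-- There is a schedule of `k` rounds after which every node `v` knows the value `f I v`. -/
def Learnable {α : Type} (k : ℕ) (f : SymTask n b → Fin n → α) : Prop :=
  ∃ S : Schedule n b, S.Realizable k ∧ ∀ v I J, S.Indist k v I J → f I v = f J v

theorem Learnable.exists_protocol {k : ℕ}
    (h : Learnable k fun (I : SymTask n b) v => I.1.received v) :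
    ∃ A : Protocol n b, A.IsCorrect ∧
      ∀ I : Task n b, I.IsSymmetric → ∀ ρ, A.SolvesWithin I ρ k := by
  obtain ⟨S, hS, hR⟩ := h
  refine ⟨S.protocol k, fun I hI ρ t v R hres => ?_, fun I hI ρ v => ?_⟩
  · rw [S.protocol_result hS hR ⟨I, hI⟩] at hres
    split_ifs at hres
    exact (Option.some.inj hres).symm
  · simp [S.protocol_result hS hR ⟨I, hI⟩]

theorem Learnable.msg : Learnable 0 fun (I : SymTask n b) v => I.1.msg v :=
  ⟨fun _ _ _ _ => none, fun t ht => absurd ht t.not_lt_zero, fun _ _ _ h => h.1⟩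

theorem Learnable.of_determined {α β : Type} {k : ℕ} {f : SymTask n b → Fin n → α}
    (h : Learnable k f) {g : SymTask n b → Fin n → β}
    (hg : ∀ v I J, f I v = f J v → g I v = g J v) : Learnable k g :=
  let ⟨S, hS, hf⟩ := h
  ⟨S, hS, fun v I J hIJ => hg v I J (hf v I J hIJ)⟩

/-- One further round of communication. -/
theorem Learnable.round {α : Type} {k : ℕ} {f : SymTask n b → Fin n → α} (h : Learnable k f)
    {X : SymTask n b → Fin n → Fin n → Option (Msg n b)}
    (hX : ∀ u I J, f I u = f J u → X I u = X J u) :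
    Learnable (k + 1) fun I v => (f I v, fun u => X I u v) := by
  obtain ⟨S, hS, hf⟩ := h
  have key : ∀ {t : ℕ}, t ≤ k → ∀ {v I J},
      Schedule.Indist (Function.update S k X) t v I J → S.Indist t v I J := by
    intro t ht v I J hIJ
    simpa only [Schedule.Indist, Schedule.history_update S k X _ _ ht] using hIJ
  refine ⟨Function.update S k X, fun t ht v I J hIJ => ?_, fun v I J hIJ => ?_⟩
  · have hIJ' := key (Nat.lt_succ_iff.1 ht) hIJ
    rcases (Nat.lt_succ_iff.1 ht).lt_or_eq with h | rfl
    · simpa [Function.update_of_ne h.ne] using hS t h v I J hIJ'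
    · simpa using hX v I J (hf v I J hIJ')
  · obtain ⟨hmsg, hhist⟩ := hIJ
    simp only [Schedule.history, List.cons.injEq, Function.update_self] at hhist
    rw [Prod.mk.injEq]
    exact ⟨hf v I J (key le_rfl ⟨hmsg, hhist.2⟩), hhist.1⟩

/-- `m` further rounds of communication, whose contents are all known at the beginning. -/
theorem Learnable.rounds {α : Type} {k : ℕ} {f : SymTask n b → Fin n → α} (h : Learnable k f)
    {X : ℕ → SymTask n b → Fin n → Fin n → Option (Msg n b)}
    (hX : ∀ i u I J, f I u = f J u → X i I u = X i J u) (m : ℕ) :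
    Learnable (k + m) fun I v => (f I v, fun (i : Fin m) u => X i I u v) := by
  induction m with
  | zero => exact h.of_determined fun v I J hIJ => by simpa using ⟨hIJ, funext fun i => i.elim0⟩
  | succ m ih =>
    refine (ih.round (X := X m) fun u I J hIJ => hX m u I J (Prod.mk.inj hIJ).1).of_determined
      fun v I J hIJ => ?_
    simp only [Prod.mk.injEq] at hIJ ⊢
    refine ⟨hIJ.1.1, funext fun i => ?_⟩
    rcases Fin.eq_castSucc_or_eq_last i with ⟨j, rfl⟩ | rfl
    · exact congrFun hIJ.1.2 j
    · exact hIJ.2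

/-- Over every link, a family of messages indexed by a finite type can be sent in a number of rounds
equal to the cardinality of this type. -/
theorem Learnable.exchange {α ι : Type} [Fintype ι] {k : ℕ} {f : SymTask n b → Fin n → α}
    (h : Learnable k f) {X : ι → SymTask n b → Fin n → Fin n → Option (Msg n b)}
    (hX : ∀ i u I J, f I u = f J u → X i I u = X i J u) :
    Learnable (k + Fintype.card ι) fun I v i u => X i I u v := by
  let e := Fintype.equivFin ι
  let Y : ℕ → SymTask n b → Fin n → Fin n → Option (Msg n b) := fun j =>
    if hj : j < Fintype.card ι then X (e.symm ⟨j, hj⟩) else fun _ _ _ => none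
  have hY : ∀ j u I J, f I u = f J u → Y j I u = Y j J u := by
    intro j u I J hIJ
    by_cases hj : j < Fintype.card ι
    · simpa only [Y, dif_pos hj] using hX _ u I J hIJ
    · simp only [Y, dif_neg hj]
  refine (h.rounds hY (Fintype.card ι)).of_determined fun v I J hIJ => ?_
  funext i u
  have := congrFun (congrFun (Prod.mk.inj hIJ).2 (e i)) u
  simpa [Y] using this

/-! ### Even splitting and its rounding error -/

section Splitting

variable {E G X Y : Type} [Fintype G] [DecidableEq G] [Nonempty G]

/-- Embed `A` into `G × Fin q` and colour by the first coordinate: on a colour class the second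
coordinate is injective. -/
theorem exists_equidistribution (A : Finset E) :
    ∃ f : E → G, ∀ g, (A.filter fun e => f e = g).card ≤ A.card / Fintype.card G + 1 := by
  classical
  let q := A.card / Fintype.card G + 1
  have hcard : Fintype.card A ≤ Fintype.card (G × Fin q) := by
    rw [Fintype.card_coe, Fintype.card_prod, Fintype.card_fin]
    exact (Nat.lt_mul_div_succ _ Fintype.card_pos).le
  obtain ⟨φ⟩ := Function.Embedding.nonempty_of_card_le hcard
  let f : E → G := fun e => if h : e ∈ A then (φ ⟨e, h⟩).1 else Classical.arbitrary G
  refine ⟨f, fun g => ?_⟩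
  let B := A.filter fun e => f e = g
  have hB : ∀ e : B, (e : E) ∈ A := fun e => (Finset.mem_filter.1 e.2).1
  have hinj : Function.Injective fun e : B => (φ ⟨e, hB e⟩).2 := by
    intro e e' h
    have h₁ : ∀ e : B, (φ ⟨e, hB e⟩).1 = g := fun e => by
      have := (Finset.mem_filter.1 e.2).2
      simpa only [f, dif_pos (hB e)] using this
    have := φ.injective (Prod.ext ((h₁ e).trans (h₁ e').symm) h)
    exact Subtype.ext (congrArg (fun a : A => (a : E)) this)
  simpa [B, q] using Fintype.card_le_of_injective _ hinj

/-- Every class of a finite set can be distributed evenly over a type `G`. -/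
theorem exists_split [DecidableEq X] (A : Finset E) (κ : E → X) :
    ∃ f : E → G, ∀ x g, (A.filter fun e => κ e = x ∧ f e = g).card ≤
      (A.filter fun e => κ e = x).card / Fintype.card G + 1 := by
  choose f hf using fun x => exists_equidistribution (G := G) (A.filter fun e => κ e = x)
  refine ⟨fun e => f (κ e) e, fun x g => le_trans (Finset.card_le_card ?_) (hf x g)⟩
  intro e he
  simp only [Finset.mem_filter] at he ⊢
  obtain ⟨h, rfl, hg⟩ := he
  exact ⟨⟨h, rfl⟩, hg⟩

/-- An even distribution over `G` of the classes of a finite set. -/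
noncomputable def split [DecidableEq X] (A : Finset E) (κ : E → X) : E → G :=
  (exists_split A κ).choose

theorem card_split_le [DecidableEq X] (A : Finset E) (κ : E → X) (x : X) (g : G) :
    (A.filter fun e => κ e = x ∧ split A κ e = g).card ≤
      (A.filter fun e => κ e = x).card / Fintype.card G + 1 :=
  (exists_split A κ).choose_spec x g

/-- If at every location each class is distributed evenly over `G`, then every union of finitely
many (location, class) pairs is distributed evenly up to the number of these pairs. -/
theorem card_local_split_le [DecidableEq X] [DecidableEq Y] (A : Finset E) (L : E → Y) (κ : E → X)
    (Z : Finset (Y × X)) (g : G) :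
    (A.filter fun e => (L e, κ e) ∈ Z ∧ split (A.filter fun e' => L e' = L e) κ e = g).card ≤
      (A.filter fun e => (L e, κ e) ∈ Z).card / Fintype.card G + Z.card := by
  classical
  have h₁ := Finset.card_eq_sum_card_fiberwise (f := fun e => (L e, κ e)) (t := Z)
    (s := A.filter fun e => (L e, κ e) ∈ Z ∧ split (A.filter fun e' => L e' = L e) κ e = g)
    (fun e he => (Finset.mem_filter.1 he).2.1)
  have h₂ := Finset.card_eq_sum_card_fiberwise (f := fun e => (L e, κ e)) (t := Z)
    (s := A.filter fun e => (L e, κ e) ∈ Z) (fun e he => (Finset.mem_filter.1 he).2)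
  rw [h₁, h₂]
  calc _ ≤ ∑ z ∈ Z, (((A.filter fun e => (L e, κ e) ∈ Z).filter fun e =>
          (L e, κ e) = z).card / Fintype.card G + 1) := by
        refine Finset.sum_le_sum fun z hz => ?_
        have := card_split_le (G := G) (A.filter fun e => L e = z.1) κ z.2 g
        refine le_trans (Finset.card_le_card ?_) (this.trans ?_)
        · intro e he
          simp only [Finset.mem_filter] at he ⊢
          obtain ⟨⟨h, _, hg⟩, rfl⟩ := he
          exact ⟨⟨h, rfl⟩, rfl, hg⟩
        · gcongr
          intro e he
          simp only [Finset.mem_filter] at he ⊢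
          obtain ⟨⟨h, hL⟩, hκ⟩ := he
          have : (L e, κ e) = z := Prod.ext hL hκ
          exact ⟨⟨h, this ▸ hz⟩, this⟩
    _ = ∑ z ∈ Z, (((A.filter fun e => (L e, κ e) ∈ Z).filter fun e =>
          (L e, κ e) = z).card / Fintype.card G) + Z.card := by
        rw [Finset.sum_add_distrib, Finset.sum_const, smul_eq_mul, mul_one]
    _ ≤ _ := by
        gcongr
        -- A sum of floors is at most the floor of the sum.
        rw [Nat.le_div_iff_mul_le Fintype.card_pos, Finset.sum_mul]
        exact Finset.sum_le_sum fun z _ => Nat.div_mul_le_self _ _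

end Splitting

/-! ### Communication between virtual nodes -/

section Virtual

variable {n b : ℕ} {W Slot : Type} [Fintype Slot]

/-- If the real nodes know the values of `f` for the virtual nodes that they host, and if these
determine for every pair of virtual nodes a set of at most `C` messages to be sent from the first
to the second, then these sets can be transmitted in `C` rounds per pair of slots. -/
theorem Learnable.transmit {α : Type} {k C : ℕ} {host : Fin n → Slot → W}
    (hhost : ∀ x, ∃ v σ, host v σ = x) {f : SymTask n b → W → α}
    (h : Learnable k fun I v σ => f I (host v σ))
    {T : SymTask n b → W → W → Finset (Msg n b)}
    (hT : ∀ x I J, f I x = f J x → T I x = T J x) (hC : ∀ I x y, (T I x y).card ≤ C) :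
    Learnable (k + Fintype.card (Slot × Slot × Fin C)) fun I v σ x => T I x (host v σ) := by
  refine (h.exchange (ι := Slot × Slot × Fin C)
    (X := fun i I u v => (T I (host u i.1) (host v i.2.1)).toList[(i.2.2 : ℕ)]?) ?_).of_determined
    fun v I J hIJ => ?_
  · intro i u I J hIJ
    rw [hT _ I J (congrFun hIJ i.1)]
  · funext τ x
    obtain ⟨u, σ, rfl⟩ := hhost x
    have hl : (T I (host u σ) (host v τ)).toList = (T J (host u σ) (host v τ)).toList := by
      -- The `C` rounds reveal the entries below `C`; beyond them both lists have ended, so the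
      -- receiver recovers the whole list.
      refine List.ext_getElem? fun j => ?_
      by_cases hj : j < C
      · exact congrFun (congrFun hIJ (σ, τ, ⟨j, hj⟩)) u
      · rw [List.getElem?_eq_none, List.getElem?_eq_none]
        · rw [Finset.length_toList]
          exact (hC J _ _).trans (not_lt.1 hj)
        · rw [Finset.length_toList]
          exact (hC I _ _).trans (not_lt.1 hj)
    have := congrArg List.toFinset hl
    simpa using this

/-- All messages of an instance. -/
def Task.messages (I : Task n b) : Finset (Msg n b) :=
  Finset.univ.biUnion I.sent

variable [DecidableEq W]

/-- The messages that are at the virtual node `x` when their locations are given by `L`. -/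
def held (I : SymTask n b) (L : Msg n b → W) (x : W) : Finset (Msg n b) :=
  I.1.messages.filter fun e => L e = x

theorem mem_held {I : SymTask n b} {L : Msg n b → W} {x : W} {e : Msg n b} :
    e ∈ held I L x ↔ e ∈ I.1.messages ∧ L e = x :=
  Finset.mem_filter

variable [Fintype W]

/-- Messages can move in a constant number of rounds to locations determined by the set of messages
present at the previous location, if only a constant number of them uses the same link. -/
theorem Learnable.hop {k C : ℕ} {host : Fin n → Slot → W} (hhost : ∀ x, ∃ v σ, host v σ = x)
    {L : SymTask n b → Msg n b → W}
    (h : Learnable k fun I v σ => held I (L I) (host v σ))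
    (F : W → Finset (Msg n b) → Msg n b → W)
    (hC : ∀ I x y, ((held I (L I) x).filter fun e => F x (held I (L I) x) e = y).card ≤ C) :
    Learnable (k + Fintype.card (Slot × Slot × Fin C)) fun I v σ =>
      held I (fun e => F (L I e) (held I (L I) (L I e)) e) (host v σ) := by
  refine (h.transmit hhost (f := fun I x => held I (L I) x)
    (T := fun I x y => (held I (L I) x).filter fun e => F x (held I (L I) x) e = y)
    (fun x I J hIJ => by simp only [hIJ]) hC).of_determined fun v I J hIJ => ?_
  have key : ∀ (I : SymTask n b) y, held I (fun e => F (L I e) (held I (L I) (L I e)) e) y =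
      Finset.univ.biUnion fun x =>
        (held I (L I) x).filter fun e => F x (held I (L I) x) e = y := by
    intro I y
    ext e
    simp only [mem_held, Finset.mem_biUnion, Finset.mem_univ, true_and, Finset.mem_filter]
    constructor
    · rintro ⟨he, hy⟩
      exact ⟨_, ⟨he, rfl⟩, hy⟩
    · rintro ⟨x, ⟨he, rfl⟩, hy⟩
      exact ⟨he, hy⟩
  funext σ
  rw [key, key]
  exact congrArg (Finset.biUnion Finset.univ) (congrFun hIJ σ)

variable {G : Type} [Fintype G] [DecidableEq G] [AddCommGroup G]

/-- Messages can move within the groups of virtual nodes with equal first coordinates in a constant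
number of rounds, if the number of messages that have to move between any two nodes is linear in the
size of the groups.  They travel through intermediate nodes in arbitrary groups. -/
theorem Learnable.shuffle {k C : ℕ} {host : Fin n → Slot → G × G}
    (hhost : ∀ x, ∃ v σ, host v σ = x) {L : SymTask n b → Msg n b → G × G}
    (h : Learnable k fun I v σ => held I (L I) (host v σ))
    (F : G × G → Finset (Msg n b) → Msg n b → G × G)
    (hF : ∀ I e, (F (L I e) (held I (L I) (L I e)) e).1 = (L I e).1)
    (hC : ∀ I x y, ((held I (L I) x).filter fun e => F x (held I (L I) x) e = y).card ≤
      C * Fintype.card G) :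
    Learnable (k + 2 * Fintype.card (Slot × Slot × Fin (C + 1))) fun I v σ =>
      held I (fun e => F (L I e) (held I (L I) (L I e)) e) (host v σ) := by
  let via : G × G → Finset (Msg n b) → Msg n b → G := fun x H => split H (F x H)
  -- The message from `x` to `y` in the same group travels through `z` with `z.1 = x.2 + y.2`. Given
  -- `x` and `z` there is a single possible `y`, and splitting each class `y` over `z.2` leaves at
  -- most `C + 1` messages on the link.
  let T : SymTask n b → G × G → G × G → Finset (Msg n b) := fun I x z =>
    (held I (L I) x).filter fun e =>
      x.2 + (F x (held I (L I) x) e).2 = z.1 ∧ via x (held I (L I) x) e = z.2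
  have hTC : ∀ I x z, (T I x z).card ≤ C + 1 := by
    intro I x z
    have h₁ := card_split_le (G := G) (held I (L I) x) (F x (held I (L I) x))
      (x.1, z.1 - x.2) z.2
    refine le_trans (Finset.card_le_card fun e he => ?_) (h₁.trans ?_)
    · simp only [T, Finset.mem_filter] at he ⊢
      obtain ⟨he, h₂, h₃⟩ := he
      refine ⟨he, Prod.ext ?_ ?_, h₃⟩
      · have := hF I e
        rwa [(mem_held.1 he).2] at this
      · rw [← h₂]
        simp
    · gcongr
      exact Nat.div_le_of_le_mul ((hC I x _).trans_eq (mul_comm _ _))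
  have h₁ := h.transmit hhost (f := fun I x => held I (L I) x) (T := T)
    (fun x I J hIJ => by simp only [T, hIJ]) hTC
  -- On the second leg, `z` and `y` determine `x = (y.1, z.1 - y.2)`, so the link carries just one
  -- set `T I x z` and the same bound applies.
  have h₂ := h₁.transmit hhost (f := fun I z x => T I x z)
    (T := fun I z y => T I (y.1, z.1 - y.2) z)
    (fun z I J hIJ => by
      funext y
      exact congrFun hIJ (y.1, z.1 - y.2)) (fun I z y => hTC I _ z)
  rw [two_mul, ← add_assoc]
  refine h₂.of_determined fun v I J hIJ => ?_
  have hTmem : ∀ (I : SymTask n b) x z e, e ∈ T I x z ↔ (e ∈ I.1.messages ∧ L I e = x) ∧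
      x.2 + (F x (held I (L I) x) e).2 = z.1 ∧ via x (held I (L I) x) e = z.2 := by
    intro I x z e
    simp only [T, mem_held, Finset.mem_filter]
  have key : ∀ (I : SymTask n b) y, held I (fun e => F (L I e) (held I (L I) (L I e)) e) y =
      Finset.univ.biUnion fun z => T I (y.1, z.1 - y.2) z := by
    intro I y
    ext e
    simp only [mem_held, Finset.mem_biUnion, Finset.mem_univ, true_and]
    constructor
    · rintro ⟨he, rfl⟩
      have hx : ((F (L I e) (held I (L I) (L I e)) e).1,
          (L I e).2 + (F (L I e) (held I (L I) (L I e)) e).2 -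
            (F (L I e) (held I (L I) (L I e)) e).2) = L I e :=
        Prod.ext (hF I e) (by simp)
      exact ⟨((L I e).2 + (F (L I e) (held I (L I) (L I e)) e).2,
        via (L I e) (held I (L I) (L I e)) e), hx.symm ▸ (hTmem I _ _ e).2 ⟨⟨he, rfl⟩, rfl, rfl⟩⟩
    · rintro ⟨z, hz⟩
      obtain ⟨⟨he, hL⟩, hz, -⟩ := (hTmem I _ _ e).1 hz
      rw [← hL] at hz
      refine ⟨he, Prod.ext ((hF I e).trans (by rw [hL])) (add_left_cancel (hz.trans ?_))⟩
      rw [hL]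
      simp
  funext σ
  rw [key, key]
  exact congrArg (Finset.biUnion Finset.univ) (congrFun hIJ σ)

end Virtual

/-! ### Link loads in the stages of the routing -/

section Balancing

variable {E G W X : Type} [Fintype G] [DecidableEq G]

/-- The new locations of the items in `A` if those present at each location are moved by `F`. -/
def relocate [DecidableEq W] (A : Finset E) (L : E → W) (F : W → Finset E → E → W) (e : E) : W :=
  F (L e) (A.filter fun e' => L e' = L e) e

theorem card_relocate_le [DecidableEq W] [Fintype W] {A : Finset E} {L : E → W}
    {F : W → Finset E → E → W} {C : ℕ}
    (h : ∀ x y, ((A.filter fun e => L e = x).filter fun e =>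
      F x (A.filter fun e => L e = x) e = y).card ≤ C) (y : W) :
    (A.filter fun e => relocate A L F e = y).card ≤ C * Fintype.card W := by
  refine Finset.card_le_mul_card_image_of_maps_to (f := L) (t := Finset.univ) (fun _ _ => by simp)
    C fun x _ => le_trans (Finset.card_le_card fun e he => ?_) (h x y)
  simp only [Finset.mem_filter] at he ⊢
  obtain ⟨⟨he, hy⟩, rfl⟩ := he
  exact ⟨⟨he, rfl⟩, hy⟩

variable [Nonempty G]

/-- The form of `card_local_split_le` used below: `d` is the ideal share, and each pair in `Z` adds
at most one by rounding. -/
theorem card_le_of_split [DecidableEq W] [DecidableEq X] {A B : Finset E} {L : E → W} {κ : E → X}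
    (Z : Finset (W × X)) (g : G) {d : ℕ}
    (hB : ∀ e ∈ B, e ∈ A ∧ (L e, κ e) ∈ Z ∧ split (A.filter fun e' => L e' = L e) κ e = g)
    (hd : (A.filter fun e => (L e, κ e) ∈ Z).card ≤ d * Fintype.card G) :
    B.card ≤ d + Z.card := by
  refine (Finset.card_le_card fun e he => ?_).trans ((card_local_split_le A L κ Z g).trans ?_)
  · exact Finset.mem_filter.2 (hB e he)
  · gcongr
    exact Nat.div_le_of_le_mul (hd.trans_eq (mul_comm _ _))

/-- At a location with few items, only few of them are assigned to each element of `G`. -/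
theorem card_split_le_of_load [DecidableEq W] [DecidableEq X] [Fintype X] {A : Finset E}
    {L : E → W} (κ : E → X) {d : ℕ} {x : W}
    (h : (A.filter fun e => L e = x).card ≤ d * Fintype.card G) (g : G) :
    ((A.filter fun e => L e = x).filter fun e =>
      split (A.filter fun e => L e = x) κ e = g).card ≤ d + Fintype.card X := by
  have := card_le_of_split (A := A) (L := L) (κ := κ) (d := d)
    (B := (A.filter fun e => L e = x).filter fun e =>
      split (A.filter fun e => L e = x) κ e = g) ({x} ×ˢ Finset.univ) g ?_ ?_
  · simpa using this
  · intro e he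
    simp only [Finset.mem_filter] at he
    obtain ⟨⟨he, rfl⟩, hg⟩ := he
    exact ⟨he, by simp, hg⟩
  · refine le_trans (Finset.card_le_card fun e he => ?_) h
    simp only [Finset.mem_filter, Finset.mem_product, Finset.mem_singleton, Finset.mem_univ,
      and_true] at he ⊢
    exact he

variable (D : E → G × G)

/-- Send the items for each destination group evenly to the groups, and evenly to the members of
each of these groups. -/
noncomputable def toGroups (_ : G × G) (H : Finset E) (e : E) : G × G :=
  (split H (fun e => (D e).1) e, split H (split H (fun e => (D e).1) : E → G) e)

/-- Spread the items for each destination group evenly within the present group. -/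
noncomputable def spreadByGroup (x : G × G) (H : Finset E) (e : E) : G × G :=
  (x.1, split H (fun e => (D e).1) e)

/-- Send the items for each destination group evenly to the members of that group. -/
noncomputable def toDestGroup (_ : G × G) (H : Finset E) (e : E) : G × G :=
  ((D e).1, split H (fun e => (D e).1) e)

/-- Spread the items for each destination evenly within the present group. -/
noncomputable def spreadByDest (x : G × G) (H : Finset E) (e : E) : G × G :=
  (x.1, split H (fun e => (D e).2) e)

variable {D} {A : Finset E} {L : E → G × G}

local notation "s" => Fintype.card G

/-- The first split gives each group at most `s + s` items, the second summand being one rounding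
per class; the second split gives each member at most `2s / s + 1`. -/
theorem card_toGroups_link (h : ∀ x, (A.filter fun e => L e = x).card ≤ s * s) (x y : G × G) :
    ((A.filter fun e => L e = x).filter fun e =>
      toGroups D x (A.filter fun e => L e = x) e = y).card ≤ 3 := by
  have h₁ := card_split_le_of_load (fun e => (D e).1) (h x) y.1
  have h₂ := card_split_le (A.filter fun e => L e = x)
    (split (A.filter fun e => L e = x) fun e => (D e).1) y.1 y.2
  refine le_trans (Finset.card_le_card fun e he => ?_) (h₂.trans (Nat.succ_le_succ ?_))
  · simp only [Finset.mem_filter] at he ⊢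
    obtain ⟨he, rfl⟩ := he
    exact ⟨he, rfl, rfl⟩
  · exact Nat.div_le_of_le_mul (by linarith)

/-- The ideal share is `s³ / s`; the rounding at all `s²` locations at most doubles it. -/
theorem card_toGroups_group (h : ∀ g, (A.filter fun e => (D e).1 = g).card ≤ s * s * s) (m g : G) :
    (A.filter fun e => (relocate A L (toGroups D) e).1 = m ∧ (D e).1 = g).card ≤
      2 * s * s := by
  have := card_le_of_split (A := A) (L := L) (κ := fun e => (D e).1) (d := s * s)
    (B := A.filter fun e => (relocate A L (toGroups D) e).1 = m ∧ (D e).1 = g)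
    (Finset.univ ×ˢ {g}) m ?_ ?_
  · simpa [two_mul, add_mul] using this
  · intro e he
    simp only [Finset.mem_filter] at he
    obtain ⟨he, hm, hg⟩ := he
    exact ⟨he, Finset.mem_product.2 ⟨Finset.mem_univ _, Finset.mem_singleton.2 hg⟩, hm⟩
  · refine le_trans (Finset.card_le_card fun e he => ?_) (h g)
    simp only [Finset.mem_filter, Finset.mem_product, Finset.mem_singleton, Finset.mem_univ,
      true_and] at he ⊢
    exact he

theorem card_spreadByGroup_link {c : ℕ} (h : ∀ x, (A.filter fun e => L e = x).card ≤ c * (s * s))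
    (x y : G × G) :
    ((A.filter fun e => L e = x).filter fun e =>
      spreadByGroup D x (A.filter fun e => L e = x) e = y).card ≤ (c + 1) * s := by
  have h₁ := card_split_le_of_load (fun e => (D e).1) (d := c * s)
    ((h x).trans_eq (mul_assoc _ _ _).symm) y.2
  refine le_trans (Finset.card_le_card fun e he => ?_) (h₁.trans_eq (by ring))
  simp only [Finset.mem_filter] at he ⊢
  obtain ⟨he, rfl⟩ := he
  exact ⟨he, rfl⟩

/-- Only the `s` locations in the group of `x` contribute, so the rounding error is `s` rather than
`s²`. -/
theorem card_spreadByGroup_class {c : ℕ}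
    (h : ∀ m g, (A.filter fun e => (L e).1 = m ∧ (D e).1 = g).card ≤ c * s * s)
    (x : G × G) (g : G) :
    (A.filter fun e => relocate A L (spreadByGroup D) e = x ∧ (D e).1 = g).card ≤
      (c + 1) * s := by
  have := card_le_of_split (A := A) (L := L) (κ := fun e => (D e).1) (d := c * s)
    (B := A.filter fun e => relocate A L (spreadByGroup D) e = x ∧ (D e).1 = g)
    (({x.1} ×ˢ Finset.univ) ×ˢ {g}) x.2 ?_ ?_
  · simpa [add_mul] using this
  · intro e he
    simp only [Finset.mem_filter] at he
    obtain ⟨he, rfl, hg⟩ := he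
    exact ⟨he, Finset.mem_product.2 ⟨Finset.mem_product.2 ⟨Finset.mem_singleton.2 rfl,
      Finset.mem_univ _⟩, Finset.mem_singleton.2 hg⟩, rfl⟩
  · refine le_trans (Finset.card_le_card fun e he => ?_) (h x.1 g)
    simp only [Finset.mem_filter, Finset.mem_product, Finset.mem_singleton, Finset.mem_univ,
      and_true] at he ⊢
    exact he

/-- A link out of `x` into a given group carries only the class of that group, so a single rounding
occurs. -/
theorem card_toDestGroup_link {c : ℕ}
    (h : ∀ x g, (A.filter fun e => L e = x ∧ (D e).1 = g).card ≤ c * s) (x y : G × G) :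
    ((A.filter fun e => L e = x).filter fun e =>
      toDestGroup D x (A.filter fun e => L e = x) e = y).card ≤ c + 1 := by
  have := card_le_of_split (A := A) (L := L) (κ := fun e => (D e).1) (d := c)
    (B := (A.filter fun e => L e = x).filter fun e =>
      toDestGroup D x (A.filter fun e => L e = x) e = y) {(x, y.1)} y.2 ?_ ?_
  · simpa using this
  · intro e he
    simp only [Finset.mem_filter] at he
    obtain ⟨⟨he, rfl⟩, rfl⟩ := he
    exact ⟨he, Finset.mem_singleton.2 rfl, rfl⟩
  · simpa using h x y.1

theorem card_spreadByDest_link {c : ℕ} (h : ∀ x, (A.filter fun e => L e = x).card ≤ c * (s * s))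
    (x y : G × G) :
    ((A.filter fun e => L e = x).filter fun e =>
      spreadByDest D x (A.filter fun e => L e = x) e = y).card ≤ (c + 1) * s := by
  have h₁ := card_split_le_of_load (fun e => (D e).2) (d := c * s)
    ((h x).trans_eq (mul_assoc _ _ _).symm) y.2
  refine le_trans (Finset.card_le_card fun e he => ?_) (h₁.trans_eq (by ring))
  simp only [Finset.mem_filter] at he ⊢
  obtain ⟨he, rfl⟩ := he
  exact ⟨he, rfl⟩

/-- Items are already in their destination groups, so within a group the second coordinate
identifies the destination, and only `s` locations round. -/
theorem card_spreadByDest_class (hL : ∀ e, (L e).1 = (D e).1)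
    (h : ∀ y, (A.filter fun e => D e = y).card ≤ s * s) (x y : G × G) :
    ((A.filter fun e => relocate A L (spreadByDest D) e = x).filter fun e => D e = y).card ≤
      2 * s := by
  have := card_le_of_split (A := A) (L := L) (κ := fun e => (D e).2) (d := s)
    (B := (A.filter fun e => relocate A L (spreadByDest D) e = x).filter fun e => D e = y)
    (({x.1} ×ˢ Finset.univ) ×ˢ {y.2}) x.2 ?_ ?_
  · simpa [two_mul] using this
  · intro e he
    simp only [Finset.mem_filter] at he
    obtain ⟨⟨he, rfl⟩, rfl⟩ := he
    exact ⟨he, Finset.mem_product.2 ⟨Finset.mem_product.2 ⟨Finset.mem_singleton.2 rfl,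
      Finset.mem_univ _⟩, Finset.mem_singleton.2 rfl⟩, rfl⟩
  · refine le_trans (Finset.card_le_card fun e he => ?_) (h (x.1, y.2))
    simp only [Finset.mem_filter, Finset.mem_product, Finset.mem_singleton, Finset.mem_univ,
      and_true, hL] at he ⊢
    exact ⟨he.1, Prod.ext he.2.1 he.2.2⟩

end Balancing

/-! ### The constant-round routing algorithm -/

section Routing

variable {n b : ℕ} {Slot G : Type} [Fintype Slot] [Fintype G] [DecidableEq G] [AddCommGroup G]

theorem Task.mem_messages_iff (I : Task n b) (m : Msg n b) :
    m ∈ I.messages ↔ ∃ v i, I.msg v i = m := by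
  simp [Task.messages, Task.sent]

/-- The symmetric task can be solved in a constant number of rounds if all nodes of a square grid
`G × G` can be hosted by the real nodes, each one hosting a constant number of them, among which
the one given by `ι`. -/
theorem learnable_received {ι : Fin n → G × G} {host : Fin n → Slot → G × G} {σ₀ : Slot}
    (hhost : ∀ x, ∃ v σ, host v σ = x) (hι : ∀ v, host v σ₀ = ι v)
    (hhι : ∀ u v σ, host v σ = ι u → v = u) (hn : n ≤ Fintype.card G * Fintype.card G) :
    Learnable (35 * (Fintype.card Slot * Fintype.card Slot))
      fun (I : SymTask n b) v => I.1.received v := by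
  have hinj : Function.Injective ι := fun u v huv => hhι v u σ₀ ((hι u).trans huv)
  let D : Msg n b → G × G := fun e => ι e.dest
  let L₀ : SymTask n b → Msg n b → G × G := fun _ e => ι e.src
  let L₁ : SymTask n b → Msg n b → G × G := fun I => relocate I.1.messages (L₀ I) (toGroups D)
  let L₂ : SymTask n b → Msg n b → G × G := fun I =>
    relocate I.1.messages (L₁ I) (spreadByGroup D)
  let L₃ : SymTask n b → Msg n b → G × G := fun I => relocate I.1.messages (L₂ I) (toDestGroup D)
  let L₄ : SymTask n b → Msg n b → G × G := fun I => relocate I.1.messages (L₃ I) (spreadByDest D)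
  have hsrc : ∀ (I : SymTask n b) x, (I.1.messages.filter fun e => L₀ I e = x).card ≤
      Fintype.card G * Fintype.card G := by
    intro I x
    by_cases hx : ∃ u, ι u = x
    · obtain ⟨u, rfl⟩ := hx
      refine le_trans (Finset.card_le_card fun e he => ?_) ((Task.card_sent I.1 u).trans_le hn)
      obtain ⟨he, hu⟩ := Finset.mem_filter.1 he
      obtain ⟨v, i, rfl⟩ := (Task.mem_messages_iff _ _).1 he
      obtain rfl : v = u := hinj hu
      exact Finset.mem_image_of_mem _ (Finset.mem_univ _)
    · rw [Finset.filter_false_of_mem fun e _ he => hx ⟨_, he⟩]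
      simp
  have hreceived : ∀ (I : SymTask n b) w, held I D (ι w) = I.1.received w := by
    intro I w
    ext e
    rw [mem_held, Task.received, Finset.mem_filter]
    exact and_congr_right fun _ => hinj.eq_iff
  have hdest : ∀ (I : SymTask n b) y, (I.1.messages.filter fun e => D e = y).card ≤
      Fintype.card G * Fintype.card G := by
    intro I y
    by_cases hy : ∃ w, ι w = y
    · obtain ⟨w, rfl⟩ := hy
      exact (congrArg Finset.card (hreceived I w)).trans_le ((I.2 w).2.trans_le hn)
    · rw [Finset.filter_false_of_mem fun e _ he => hy ⟨_, he⟩]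
      simp
  have hgroup : ∀ (I : SymTask n b) g, (I.1.messages.filter fun e => (D e).1 = g).card ≤
      Fintype.card G * Fintype.card G * Fintype.card G := by
    intro I g
    refine Finset.card_le_mul_card_image_of_maps_to (f := fun e => (D e).2) (t := Finset.univ)
      (fun _ _ => by simp) _ fun p _ => le_trans (Finset.card_le_card fun e he => ?_)
        (hdest I (g, p))
    simp only [Finset.mem_filter] at he ⊢
    exact ⟨he.1.1, Prod.ext he.1.2 he.2⟩
  have h₀ : Learnable 0 fun I v σ => held I (L₀ I) (host v σ) := by
    refine Learnable.msg.of_determined fun v I J hIJ => funext fun σ => ?_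
    -- By `hhι`, a virtual node that initially holds messages is hosted only by their sender, who
    -- therefore knows them.
    have key : ∀ (I J : SymTask n b), I.1.msg v = J.1.msg v →
        held I (L₀ I) (host v σ) ⊆ held J (L₀ J) (host v σ) := by
      intro I J hIJ e he
      obtain ⟨he, hL⟩ := mem_held.1 he
      obtain ⟨u, i, rfl⟩ := (Task.mem_messages_iff _ _).1 he
      obtain rfl : v = u := hhι _ _ _ hL.symm
      exact mem_held.2 ⟨(Task.mem_messages_iff _ _).2 ⟨v, i, by rw [hIJ]⟩, hL⟩
    exact (key I J hIJ).antisymm (key J I hIJ.symm)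
  have b₁ := fun I => card_toGroups_link (D := D) (hsrc I)
  have load₁ : ∀ I y, ((I : SymTask n b).1.messages.filter fun e => L₁ I e = y).card ≤
      3 * (Fintype.card G * Fintype.card G) := fun I y =>
    (card_relocate_le (b₁ I) y).trans_eq (by rw [Fintype.card_prod])
  have b₂ := fun I => card_spreadByGroup_link (D := D) (load₁ I)
  have b₃ := fun I => card_toDestGroup_link (D := D)
    (card_spreadByGroup_class (card_toGroups_group (L := L₀ I) (hgroup I)))
  have load₃ : ∀ I y, ((I : SymTask n b).1.messages.filter fun e => L₃ I e = y).card ≤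
      4 * (Fintype.card G * Fintype.card G) := fun I y =>
    (card_relocate_le (b₃ I) y).trans_eq (by rw [Fintype.card_prod])
  have b₄ := fun I => card_spreadByDest_link (D := D) (load₃ I)
  have b₅ := fun I => card_spreadByDest_class (D := D) (L := L₃ I) (fun _ => rfl) (hdest I)
  have h₁ := h₀.hop hhost (toGroups D) b₁
  have h₂ := h₁.shuffle (L := L₁) hhost (spreadByGroup D) (fun _ _ => rfl) b₂
  have h₃ := h₂.hop (L := L₂) hhost (toDestGroup D) b₃
  have h₄ := h₃.shuffle (L := L₃) hhost (spreadByDest D) (fun _ _ => rfl) b₄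
  have h₅ := h₄.shuffle (L := L₄) hhost (fun _ _ e => D e) (fun _ _ => rfl) b₅
  -- Per pair of slots the five moves cost `3 + 2·(4 + 1) + 4 + 2·(5 + 1) + 2·(2 + 1) = 35` rounds.
  convert h₅.of_determined (g := fun I v => I.1.received v) fun v I J hIJ => ?_ using 1
  · simp only [Fintype.card_prod, Fintype.card_fin]
    ring
  · have := congrFun hIJ σ₀
    simp only [hι] at this
    exact (hreceived I v).symm.trans (this.trans (hreceived J v))

/-- The nodes of a square grid can be hosted by `n` real nodes, four of them by each one. -/
theorem exists_hosting (hn : 0 < n) :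
    ∃ r : ℕ, n ≤ (r + 1) * (r + 1) ∧ ∃ (ι : Fin n → Fin (r + 1) × Fin (r + 1))
      (host : Fin n → Fin 4 → Fin (r + 1) × Fin (r + 1)),
      (∀ x, ∃ v σ, host v σ = x) ∧ (∀ v, host v 0 = ι v) ∧
        ∀ u v σ, host v σ = ι u → v = u := by
  have h₁ : n ≤ (Nat.sqrt n + 1) * (Nat.sqrt n + 1) := (Nat.lt_succ_sqrt n).le
  -- For `r = √n ≥ 1` one has `r + 1 ≤ 2r` and `r² ≤ n`.
  have h₂ : (Nat.sqrt n + 1) * (Nat.sqrt n + 1) ≤ 4 * n := by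
    have := Nat.sqrt_le n
    have : 0 < Nat.sqrt n := Nat.sqrt_pos.2 hn
    nlinarith
  generalize Nat.sqrt n = r at h₁ h₂
  have hv : ∀ v : Fin n, (v : ℕ) < (r + 1) * (r + 1) := fun v => v.2.trans_le h₁
  let φ : Fin ((r + 1) * (r + 1)) ≃ Fin (r + 1) × Fin (r + 1) := finProdFinEquiv.symm
  -- Slot `σ` of `v` hosts the grid position `v + nσ`, whose residue modulo `n` recovers `v`. Slots
  -- beyond the grid repeat the position of `v` itself, so that no foreign `ι u` is hosted.
  refine ⟨r, h₁, fun v => φ ⟨v, hv v⟩, fun v σ =>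
    if h : (v : ℕ) + n * σ < (r + 1) * (r + 1) then φ ⟨_, h⟩ else φ ⟨v, hv v⟩,
    fun x => ?_, fun v => ?_, fun u v σ h => ?_⟩
  · refine ⟨⟨(φ.symm x : ℕ) % n, Nat.mod_lt _ hn⟩, ⟨(φ.symm x : ℕ) / n,
      Nat.div_lt_of_lt_mul ((φ.symm x).2.trans_le (h₂.trans_eq (mul_comm _ _)))⟩, ?_⟩
    simp [Nat.mod_add_div]
  · simp [hv v]
  · beta_reduce at h
    split_ifs at h with hσ
    · have h₃ : (v : ℕ) + n * σ = u := congrArg Fin.val (φ.injective h)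
      have h₄ := congrArg (· % n) h₃
      simp only [Nat.add_mul_mod_self_left, Nat.mod_eq_of_lt v.2, Nat.mod_eq_of_lt u.2] at h₄
      exact Fin.ext h₄
    · exact Fin.ext (Fin.mk.inj (φ.injective h))

/-- The symmetric task can be solved deterministically, hence in particular with every required
probability, in a constant number of rounds: the messages are routed through the groups of a grid,
each node distributing evenly the messages that it holds of each class, and this local balancing
keeps the load of every link bounded. -/
theorem exists_protocol_solving (n b : ℕ) : ∃ A : Protocol n b, A.IsCorrect ∧
    ∀ I : Task n b, I.IsSymmetric → ∀ ρ, A.SolvesWithin I ρ 560 := by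
  rcases Nat.eq_zero_or_pos n with rfl | hn
  · exact ⟨⟨fun v => v.elim0, fun v => v.elim0⟩, fun _ _ _ _ v => v.elim0, fun _ _ _ v => v.elim0⟩
  · obtain ⟨r, hr, ι, host, h₁, h₂, h₃⟩ := exists_hosting hn
    have := learnable_received (b := b) h₁ h₂ h₃ (by simpa using hr)
    -- With four slots, `35 · 4 · 4 = 560`.
    simp only [Fintype.card_fin] at this
    exact this.exists_protocol

end Routing

instance (n : ℕ) : IsProbabilityMeasure (coins n) := by
  unfold coins
  infer_instance

/-! ### At least one round is necessary -/

section LowerBound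

variable {n : ℕ}

/-- The instance with trivial payloads in which the `i`-th message of `v` goes to `σ v i`. -/
def permTask (b : ℕ) (σ : Fin n → Equiv.Perm (Fin n)) : Task n b where
  dest v i := σ v i
  payload _ _ _ := false

theorem isSymmetric_permTask (b : ℕ) (σ : Fin n → Equiv.Perm (Fin n)) :
    (permTask b σ).IsSymmetric := by
  refine fun w => ⟨Task.card_sent _ w, ?_⟩
  have : (permTask b σ).received w =
      Finset.univ.image fun v => (permTask b σ).msg v ((σ v).symm w) := by
    ext m
    rw [Task.mem_received_iff]
    simp only [Finset.mem_image, Finset.mem_univ, true_and]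
    constructor
    · rintro ⟨v, i, rfl, h⟩
      refine ⟨v, ?_⟩
      rw [← h]
      simp [permTask]
    · rintro ⟨v, rfl⟩
      exact ⟨v, _, rfl, by simp [permTask]⟩
  rw [this, Finset.card_image_of_injective, Finset.card_univ, Fintype.card_fin]
  intro u v h
  exact congrArg Msg.src h

/-- Without communication, a node outputs the same on two instances that agree on its own
messages. -/
theorem not_solves_in_zero_rounds {b : ℕ} (B : Protocol n b) {I J : Task n b} {v : Fin n}
    (hmsg : I.msg v = J.msg v) (hne : I.received v ≠ J.received v)
    (hI : 1 / 2 < (coins n).real {ρ | B.SolvesWithin I ρ 0})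
    (hJ : 1 / 2 < (coins n).real {ρ | B.SolvesWithin J ρ 0}) : False := by
  -- These events depend only on the bits of `v`. For distinct outputs they are disjoint, yet both
  -- would have probability above `1/2`. Only their measurability is needed, not that of the success
  -- events.
  let E : Finset (Msg n b) → Set (Fin n → ℕ → Bool) := fun R =>
    {ρ | B.act v (I.msg v) (ρ v) [] = .halt R}
  have heval : Measurable fun ρ : Fin n → ℕ → Bool => ρ v := measurable_pi_apply v
  have hmeas : ∀ R, MeasurableSet (E R) := fun R =>
    heval (B.measurable_act v (I.msg v) [] (.halt R))
  have hsub : ∀ K : Task n b, K.msg v = I.msg v →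
      {ρ | B.SolvesWithin K ρ 0} ⊆ E (K.received v) := by
    intro K hK ρ hρ
    have h := hρ v
    unfold Protocol.result at h
    simp only [Protocol.view, hK] at h
    change B.act v (I.msg v) (ρ v) [] = _
    split at h
    · rename_i R hR
      rw [hR, Option.some.inj h]
    · cases h
  have hdisj : Disjoint (E (I.received v)) (E (J.received v)) := by
    rw [Set.disjoint_left]
    intro ρ h₁ h₂
    have h : Action.halt (I.received v) = Action.halt (J.received v) := h₁.symm.trans h₂
    exact hne (Action.halt.inj h)
  have h₁ := measureReal_mono (μ := coins n) (hsub I rfl)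
  have h₂ := measureReal_mono (μ := coins n) (hsub J hmsg.symm)
  have h₃ := measureReal_union (μ := coins n) hdisj (hmeas _)
  have h₄ : (coins n).real (E (I.received v) ∪ E (J.received v)) ≤ 1 := measureReal_le_one
  linarith

theorem one_le_of_solves {b T : ℕ} (hn : 2 ≤ n) (B : Protocol n b)
    (h : ∀ I : Task n b, I.IsSymmetric →
      1 / 2 < (coins n).real {ρ | B.SolvesWithin I ρ T}) : 1 ≤ T := by
  by_contra hT
  obtain rfl : T = 0 := by omega
  let x : Fin n := ⟨0, by omega⟩
  let y : Fin n := ⟨1, by omega⟩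
  have hxy : x ≠ y := by simp [x, y]
  -- Only the list of `y` is altered, which `x` cannot see: the message of `y` at position `x` now
  -- goes to `y` instead of `x`.
  let σ : Fin n → Equiv.Perm (Fin n) := fun v => if v = y then Equiv.swap x y else 1
  refine not_solves_in_zero_rounds B (I := permTask b 1) (J := permTask b σ) (v := x) ?_ ?_
    (h _ (isSymmetric_permTask b _)) (h _ (isSymmetric_permTask b _))
  · funext i
    simp [Task.msg, permTask, σ, hxy]
  · intro heq
    have hmem : (permTask b 1).msg y x ∈ (permTask b 1).received x :=
      (Task.mem_received_iff _ _ _).2 ⟨y, x, rfl, rfl⟩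
    rw [heq, Task.mem_received_iff] at hmem
    obtain ⟨v, i, hm, hd⟩ := hmem
    have hv : v = y := congrArg Msg.src hm
    have hi : i = x := congrArg Msg.idx hm
    subst hv hi
    simp [permTask, σ] at hd
    exact hxy hd.symm

end LowerBound

end InfoDistribution

theorem mainTheorem7 :
    (∃ A : (n b : ℕ) → InfoDistribution.Protocol n b,
      (∀ n b : ℕ, (A n b).IsCorrect) ∧
      ∀ c : ℝ, 0 < c → ∃ K : ℕ, ∀ n b : ℕ, 1 ≤ n →
        ∀ I : InfoDistribution.Task n b, I.IsSymmetric →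
          1 - 1 / (n : ℝ) ^ c ≤
            (InfoDistribution.coins n).real {ρ | (A n b).SolvesWithin I ρ K}) ∧
    (∀ n b : ℕ, 2 ≤ n → ∀ (B : InfoDistribution.Protocol n b) (T : ℕ),
      (∀ I : InfoDistribution.Task n b, I.IsSymmetric →
        1 / 2 < (InfoDistribution.coins n).real {ρ | B.SolvesWithin I ρ T}) →
      1 ≤ T) := by
  choose A hcorrect hsolves using InfoDistribution.exists_protocol_solving
  refine ⟨⟨A, hcorrect, fun c _ => ⟨560, fun n b _ I hI => ?_⟩⟩,
    fun n b hn B T h => InfoDistribution.one_le_of_solves hn B h⟩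
  have huniv : {ρ | (A n b).SolvesWithin I ρ 560} = Set.univ :=
    Set.eq_univ_of_forall (hsolves n b I hI)
  rw [huniv, MeasureTheory.probReal_univ]
  have : (0 : ℝ) ≤ 1 / (n : ℝ) ^ c := by positivity
  linarith
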